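/- A \emph{tolerance} on a lattice $S$ is a reflexive and symmetric relation $\gamma$ on $S$ such that $a\mathrel{\gamma}b$ and $c\mathrel{\gamma}d$ imply $a\vee c\mathrel{\gamma}b\vee d$ and $a\wedge c\mathrel{\gamma}b\wedge d$; write $x\le_\gamma y$ for "$x\le y$ and $x\mathrel{\gamma}y$". Filters and ideals of a lattice are nonempty and may be improper. A \emph{modular connected system} (m.c. system) consists of a lattice $S$ (the skeleton), a tolerance $\gamma$ on $S$, a family of lattices $(L_x)_{x\in S}$ (the blocks), and a family of maps $(\varphi_x^y)_{x\le_\gamma y}$ (the connections), such that: (1) every interval of $S$ is finite, and every element of $S$ has only finitely many upper covers and finitely many lower covers; (2) each $L_x$ is a finite complemented modular lattice; (3) each $\varphi_x^y$ is a lattice isomorphism from a filter $F_x^y$ of $L_x$ onto an ideal $I_x^y$ of $L_y$; (4) $F_x^x=I_x^x=L_x$ and $\varphi_x^x=\mathrm{id}_{L_x}$; (5) if $x\le_\gamma y\le_\gamma z$ and $I_x^y\cap F_y^z\ne\emptyset$, then $x\mathrel{\gamma}z$; (6) if $x\le z\le y$ and $x\mathrel{\gamma}y$ (so that also $x\mathrel{\gamma}z$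 and $z\mathrel{\gamma}y$), then $F_x^y=(\varphi_x^z)^{-1}(I_x^z\cap F_z^y)$, $I_x^y=\varphi_z^y(I_x^z\cap F_z^y)$, and $\varphi_x^y=\varphi_z^y\circ\varphi_x^z|_{F_x^y}$; (7) if $x\mathrel{\gamma}y$ (so that $\gamma$ holds between any two of $x,\,y,\,x\vee y,\,x\wedge y$), then $I_x^{x\vee y}\cap I_y^{x\vee y}\subseteq I_{x\wedge y}^{x\vee y}$ and $F_{x\wedge y}^x\cap F_{x\wedge y}^y\subseteq F_{x\wedge y}^{x\vee y}$; (8) if $y$ covers $x$ in $S$, then $x\mathrel{\gamma}y$, $F_x^y\ne L_x$, and $I_x^y\ne L_y$. On $M=\{(x,a): x\in S,\ a\in L_x\}$ let $(x,a)\sim(y,b)$ iff $x\mathrel{\gamma}y$, $a\in F_x^{x\vee y}$, $b\in F_y^{x\vee y}$ and $\varphi_x^{x\vee y}(a)=\varphi_y^{x\vee y}(b)$. This is an equivalence relation. The \emph{sum} of the system is $L=M/{\sim}$; let $\pi_x:L_x\to L$ send $a$ to the class of $(x,a)$. For $p,q\in L$ and $x\in S$, write $p\le_x q$ if there are $a\le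 b$ in $L_x$ with $\pi_x(a)=p$ and $\pi_x(b)=q$. Define $p\le q$ in $L$ iff for some $n\ge 0$ there are $x_1\le x_2\le\cdots\le x_n$ in $S$ and $p=a_0,a_1,\dots,a_n=q$ in $L$ with $a_{i-1}\le_{x_i}a_i$ for $1\le i\le n$. \textbf{Theorem.} For every m.c. system, the relation $\le$ is a lattice order on its sum $L$ (a partial order in which any two elements have a supremum and an infimum), and the lattice $L$ is modular. -/

import Mathlib

universe u v

/-- A tolerance on a lattice: a reflexive and symmetric relation compatible with join and meet. -/
structure IsTolerance {S : Type u} [Lattice S] (γ : S → S → Prop) : Prop where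
  refl : ∀ x, γ x x
  symm : ∀ {x y}, γ x y → γ y x
  sup : ∀ {a b c d}, γ a b → γ c d → γ (a ⊔ c) (b ⊔ d)
  inf : ∀ {a b c d}, γ a b → γ c d → γ (a ⊓ c) (b ⊓ d)

/-- The relation `x ≤_γ y`: both `x ≤ y` and `x γ y`. -/
def TolLE {S : Type u} [Lattice S] (γ : S → S → Prop) (x y : S) : Prop :=
  x ≤ y ∧ γ x y

namespace IsTolerance

variable {S : Type u} [Lattice S] {γ : S → S → Prop}

theorem tolLE_refl (hγ : IsTolerance γ) (x : S) : TolLE γ x x :=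
  ⟨le_rfl, hγ.refl x⟩

theorem tolLE_lower (hγ : IsTolerance γ) {x z y : S} (hxz : x ≤ z) (hzy : z ≤ y)
    (h : γ x y) : TolLE γ x z := by
  refine ⟨hxz, ?_⟩
  have := hγ.inf h (hγ.refl z)
  rwa [inf_eq_left.2 hxz, inf_eq_right.2 hzy] at this

theorem tolLE_upper (hγ : IsTolerance γ) {x z y : S} (hxz : x ≤ z) (hzy : z ≤ y)
    (h : γ x y) : TolLE γ z y := by
  refine ⟨hzy, ?_⟩
  have := hγ.sup h (hγ.refl z)
  rwa [sup_eq_right.2 hxz, sup_eq_left.2 hzy] at this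

theorem tolLE_inf_sup (hγ : IsTolerance γ) {x y : S} (h : γ x y) :
    TolLE γ (x ⊓ y) (x ⊔ y) := by
  refine ⟨inf_le_left.trans le_sup_left, ?_⟩
  have h1 : γ x (x ⊔ y) := by simpa using hγ.sup (hγ.refl x) h
  have h2 : γ y (x ⊔ y) := by simpa using hγ.sup (hγ.symm h) (hγ.refl y)
  simpa using hγ.inf h1 h2

theorem tolLE_left_sup (hγ : IsTolerance γ) {x y : S} (h : γ x y) : TolLE γ x (x ⊔ y) :=
  hγ.tolLE_upper inf_le_left le_sup_left (hγ.tolLE_inf_sup h).2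

theorem tolLE_right_sup (hγ : IsTolerance γ) {x y : S} (h : γ x y) : TolLE γ y (x ⊔ y) :=
  hγ.tolLE_upper inf_le_right le_sup_right (hγ.tolLE_inf_sup h).2

theorem tolLE_inf_left (hγ : IsTolerance γ) {x y : S} (h : γ x y) : TolLE γ (x ⊓ y) x :=
  hγ.tolLE_lower inf_le_left le_sup_left (hγ.tolLE_inf_sup h).2

theorem tolLE_inf_right (hγ : IsTolerance γ) {x y : S} (h : γ x y) : TolLE γ (x ⊓ y) y :=
  hγ.tolLE_lower inf_le_right le_sup_right (hγ.tolLE_inf_sup h).2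

end IsTolerance

/-- A modular connected system with skeleton lattice `S` and family of blocks `L`.
Filters and ideals are nonempty (and possibly improper), as in Mathlib. -/
structure MCSystem (S : Type u) [Lattice S] (L : S → Type v) [∀ x, Lattice (L x)]
    [∀ x, BoundedOrder (L x)] where
  /-- the overlap tolerance -/
  γ : S → S → Prop
  isTolerance : IsTolerance γ
  /-- the source of the connection from `L x` to `L y`, a lattice filter of `L x` -/
  F : ∀ {x y : S}, TolLE γ x y → Order.PFilter (L x)
  /-- the target of the connection from `L x` to `L y`, a lattice ideal of `L y` -/
  I : ∀ {x y : S}, TolLE γ x y → Order.Ideal (L y)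
  /-- the connections, which are lattice isomorphisms -/
  φ : ∀ {x y : S} (h : TolLE γ x y), F h ≃o I h
  /-- the skeleton is locally finite -/
  skeleton_locallyFinite : ∀ x y : S, (Set.Icc x y).Finite
  /-- the skeleton has finite upper covers -/
  skeleton_upperCovers : ∀ x : S, {y | x ⋖ y}.Finite
  /-- the skeleton has finite lower covers -/
  skeleton_lowerCovers : ∀ x : S, {y | y ⋖ x}.Finite
  block_finite : ∀ x, Finite (L x)
  block_modular : ∀ x, IsModularLattice (L x)
  block_complemented : ∀ x, ComplementedLattice (L x)
  F_self : ∀ (x : S) (a : L x), a ∈ F (isTolerance.tolLE_refl x)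
  I_self : ∀ (x : S) (a : L x), a ∈ I (isTolerance.tolLE_refl x)
  φ_self : ∀ (x : S) (a : F (isTolerance.tolLE_refl x)),
    (φ (isTolerance.tolLE_refl x) a : L x) = a
  tol_of_inter_nonempty : ∀ {x y z : S} (hxy : TolLE γ x y) (hyz : TolLE γ y z),
    ((I hxy : Set (L y)) ∩ (F hyz : Set (L y))).Nonempty → γ x z
  /-- `F x y = φ x z ⁻¹ (I x z ∩ F z y)` -/
  F_eq : ∀ {x z y : S} (hxz : x ≤ z) (hzy : z ≤ y) (h : γ x y),
    (F ⟨hxz.trans hzy, h⟩ : Set (L x)) =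
      {a | ∃ ha : a ∈ F (isTolerance.tolLE_lower hxz hzy h),
        (φ (isTolerance.tolLE_lower hxz hzy h) ⟨a, ha⟩ : L z) ∈
          F (isTolerance.tolLE_upper hxz hzy h)}
  /-- `I x y = φ z y (I x z ∩ F z y)` -/
  I_eq : ∀ {x z y : S} (hxz : x ≤ z) (hzy : z ≤ y) (h : γ x y),
    (I ⟨hxz.trans hzy, h⟩ : Set (L y)) =
      {c | ∃ b : F (isTolerance.tolLE_upper hxz hzy h),
        (b : L z) ∈ I (isTolerance.tolLE_lower hxz hzy h) ∧
          (φ (isTolerance.tolLE_upper hxz hzy h) b : L y) = c}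
  /-- `φ x y = φ z y ∘ φ x z` on `F x y` -/
  φ_comp : ∀ {x z y : S} (hxz : x ≤ z) (hzy : z ≤ y) (h : γ x y) (a : L x)
    (ha : a ∈ F ⟨hxz.trans hzy, h⟩) (ha' : a ∈ F (isTolerance.tolLE_lower hxz hzy h))
    (hb : (φ (isTolerance.tolLE_lower hxz hzy h) ⟨a, ha'⟩ : L z) ∈
      F (isTolerance.tolLE_upper hxz hzy h)),
    (φ ⟨hxz.trans hzy, h⟩ ⟨a, ha⟩ : L y) =
      φ (isTolerance.tolLE_upper hxz hzy h)
        ⟨φ (isTolerance.tolLE_lower hxz hzy h) ⟨a, ha'⟩, hb⟩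
  I_inter_subset : ∀ {x y : S} (h : γ x y),
    (I (isTolerance.tolLE_left_sup h) ∩ I (isTolerance.tolLE_right_sup h) : Set (L (x ⊔ y))) ⊆
      I (isTolerance.tolLE_inf_sup h)
  F_inter_subset : ∀ {x y : S} (h : γ x y),
    (F (isTolerance.tolLE_inf_left h) ∩ F (isTolerance.tolLE_inf_right h) : Set (L (x ⊓ y))) ⊆
      F (isTolerance.tolLE_inf_sup h)
  tol_of_covBy : ∀ {x y : S}, x ⋖ y → γ x y
  F_ne_of_covBy : ∀ {x y : S} (h : x ⋖ y),
    (F ⟨h.le, tol_of_covBy h⟩ : Set (L x)) ≠ Set.univ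
  I_ne_of_covBy : ∀ {x y : S} (h : x ⋖ y),
    (I ⟨h.le, tol_of_covBy h⟩ : Set (L y)) ≠ Set.univ

namespace MCSystem

variable {S : Type u} [Lattice S] {L : S → Type v} [∀ x, Lattice (L x)]
  [∀ x, BoundedOrder (L x)] (C : MCSystem S L)

/-- The relation `(x, a) ∼ (y, b)` on the disjoint union of the blocks: `x γ y`,
`a ∈ F x (x ⊔ y)`, `b ∈ F y (x ⊔ y)` and `a`, `b` have the same image in `L (x ⊔ y)`. -/
def Sim (p q : Σ x, L x) : Prop :=
  ∃ (h : C.γ p.1 q.1) (ha : p.2 ∈ C.F (C.isTolerance.tolLE_left_sup h))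
    (hb : q.2 ∈ C.F (C.isTolerance.tolLE_right_sup h)),
    (C.φ (C.isTolerance.tolLE_left_sup h) ⟨p.2, ha⟩ : L (p.1 ⊔ q.1)) =
      C.φ (C.isTolerance.tolLE_right_sup h) ⟨q.2, hb⟩

/-! That `∼` is an equivalence relation is proved through the graphs of the connections. -/

/-- `x ≤_γ y`, `a ∈ F x y`, and the connection from `L x` to `L y` maps `a` to `b`. -/
def Conn (x y : S) (a : L x) (b : L y) : Prop :=
  ∃ (h : TolLE C.γ x y) (ha : a ∈ C.F h), (C.φ h ⟨a, ha⟩ : L y) = b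

variable {C}

theorem Conn.right_unique {x y : S} {a : L x} {b b' : L y} (h : C.Conn x y a b)
    (h' : C.Conn x y a b') : b = b' := by
  obtain ⟨h1, h2, rfl⟩ := h
  obtain ⟨h3, h4, rfl⟩ := h'
  rfl

theorem Conn.left_unique {x y : S} {a a' : L x} {b : L y} (h : C.Conn x y a b)
    (h' : C.Conn x y a' b) : a = a' := by
  obtain ⟨h1, h2, rfl⟩ := h
  obtain ⟨h3, h4, h5⟩ := h'
  have := (C.φ h1).injective (Subtype.ext h5)
  exact (congrArg Subtype.val this).symm

theorem Conn.mem_I {x y : S} {a : L x} {b : L y} (h : C.Conn x y a b) : b ∈ C.I h.1 := by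
  obtain ⟨h1, h2, rfl⟩ := h
  exact (C.φ h1 ⟨a, h2⟩).2

theorem Conn.refl (x : S) (a : L x) : C.Conn x x a a :=
  ⟨C.isTolerance.tolLE_refl x, C.F_self x a, C.φ_self x _⟩

theorem Conn.trans {x z y : S} {a : L x} {b : L z} {c : L y} (h1 : C.Conn x z a b)
    (h2 : C.Conn z y b c) : C.Conn x y a c := by
  have hγ : C.γ x y := C.tol_of_inter_nonempty h1.1 h2.1 ⟨b, h1.mem_I, h2.2.1⟩
  obtain ⟨h3, h4, rfl⟩ := h1
  obtain ⟨h5, h6, rfl⟩ := h2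
  have hF := C.F_eq h3.1 h5.1 hγ
  have ha : a ∈ (C.F ⟨h3.1.trans h5.1, hγ⟩ : Set (L x)) := by
    rw [hF]; exact ⟨h4, h6⟩
  exact ⟨⟨h3.1.trans h5.1, hγ⟩, ha, C.φ_comp h3.1 h5.1 hγ a ha h4 h6⟩

theorem Conn.interpolate {x z y : S} {a : L x} {c : L y} (h : C.Conn x y a c)
    (hxz : x ≤ z) (hzy : z ≤ y) : ∃ b, C.Conn x z a b ∧ C.Conn z y b c := by
  obtain ⟨h1, h2, rfl⟩ := h
  have ha : a ∈ (C.F ⟨hxz.trans hzy, h1.2⟩ : Set (L x)) := h2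
  rw [C.F_eq hxz hzy h1.2] at ha
  obtain ⟨h3, h4⟩ := ha
  exact ⟨_, ⟨_, h3, rfl⟩, ⟨_, h4, (C.φ_comp hxz hzy h1.2 a h2 h3 h4).symm⟩⟩

theorem Conn.amalgamate {z x y : S} {d : L z} {a : L x} {b : L y} (h1 : C.Conn z x d a)
    (h2 : C.Conn z y d b) :
    ∃ c, C.Conn x (x ⊔ y) a c ∧ C.Conn y (x ⊔ y) b c := by
  obtain ⟨d', h3, h4⟩ := h1.interpolate (le_inf h1.1.1 h2.1.1) inf_le_left
  obtain ⟨d'', h5, h6⟩ := h2.interpolate (le_inf h1.1.1 h2.1.1) inf_le_right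
  obtain rfl := h3.right_unique h5
  have hγ : C.γ x y := by
    have := C.isTolerance.sup (C.isTolerance.symm h4.1.2) h6.1.2
    rwa [sup_eq_left.2 inf_le_left, sup_eq_right.2 inf_le_right] at this
  have hd : d' ∈ C.F (C.isTolerance.tolLE_inf_sup hγ) :=
    C.F_inter_subset hγ ⟨h4.2.1, h6.2.1⟩
  have h7 : C.Conn (x ⊓ y) (x ⊔ y) d' _ := ⟨_, hd, rfl⟩
  obtain ⟨a', h8, h9⟩ := h7.interpolate inf_le_left le_sup_left
  obtain ⟨b', h10, h11⟩ := h7.interpolate inf_le_right le_sup_right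
  obtain rfl := h4.right_unique h8
  obtain rfl := h6.right_unique h10
  exact ⟨_, h9, h11⟩

theorem sim_iff_conn {p q : Σ x, L x} : C.Sim p q ↔
    ∃ c, C.Conn p.1 (p.1 ⊔ q.1) p.2 c ∧ C.Conn q.1 (p.1 ⊔ q.1) q.2 c := by
  constructor
  · rintro ⟨h, ha, hb, hab⟩
    exact ⟨_, ⟨_, ha, hab⟩, ⟨_, hb, rfl⟩⟩
  · rintro ⟨c, ⟨h1, ha, rfl⟩, ⟨h2, hb, h⟩⟩
    have hγ : C.γ p.1 q.1 := by
      have := C.isTolerance.inf h1.2 (C.isTolerance.symm h2.2)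
      rwa [inf_eq_left.2 le_sup_left, inf_eq_right.2 le_sup_right] at this
    exact ⟨hγ, ha, hb, h.symm⟩

theorem sim_of_conn {p q : Σ x, L x} {y : S} {c : L y} (h1 : C.Conn p.1 y p.2 c)
    (h2 : C.Conn q.1 y q.2 c) : C.Sim p q := by
  obtain ⟨a, h3, h4⟩ := h1.interpolate le_sup_left (sup_le h1.1.1 h2.1.1)
  obtain ⟨b, h5, h6⟩ := h2.interpolate le_sup_right (sup_le h1.1.1 h2.1.1)
  obtain rfl := h4.left_unique h6
  exact sim_iff_conn.2 ⟨a, h3, h5⟩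

variable (C)

theorem sim_equivalence : Equivalence C.Sim where
  refl p := sim_of_conn (Conn.refl p.1 p.2) (Conn.refl p.1 p.2)
  symm h := by
    obtain ⟨c, h1, h2⟩ := sim_iff_conn.1 h
    exact sim_of_conn h2 h1
  trans h h' := by
    obtain ⟨c, h1, h2⟩ := sim_iff_conn.1 h
    obtain ⟨c', h3, h4⟩ := sim_iff_conn.1 h'
    obtain ⟨e, h5, h6⟩ := h2.amalgamate h3
    exact sim_of_conn (h1.trans h5) (h4.trans h6)

/-- The relation `∼` as a setoid. -/
def simSetoid : Setoid (Σ x, L x) := ⟨C.Sim, C.sim_equivalence⟩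

/-- The sum of a modular connected system: the disjoint union of its blocks modulo `∼`. -/
def Sum : Type (max u v) := Quotient C.simSetoid

/-- The canonical map from the block `L x` to the sum. -/
def π (x : S) (a : L x) : C.Sum := Quotient.mk C.simSetoid ⟨x, a⟩

/-- The relation `p ≤_x q` on the sum: both `p` and `q` lie in the image of the block `L x`,
and the preimage of `p` is below the preimage of `q` in `L x`. -/
def BlockLE (x : S) (p q : C.Sum) : Prop :=
  ∃ a b : L x, C.π x a = p ∧ C.π x b = q ∧ a ≤ b

/-- The pair of `x 0, …, x (n - 1)` and `a 0, …, a n` is an ascending sequence of length `n`: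
`x 0 ≤ ⋯ ≤ x (n - 1)` in the skeleton, and `a i ≤_{x i} a (i + 1)` for all `i < n`. -/
def IsAscending {n : ℕ} (x : Fin n → S) (a : Fin (n + 1) → C.Sum) : Prop :=
  Monotone x ∧ ∀ i : Fin n, C.BlockLE (x i) (a i.castSucc) (a i.succ)

/-- The order of the sum: `p ≤ q` when some ascending sequence leads from `p` to `q`. -/
def SumLE (p q : C.Sum) : Prop :=
  ∃ (n : ℕ) (x : Fin n → S) (a : Fin (n + 1) → C.Sum),
    C.IsAscending x a ∧ a 0 = p ∧ a (Fin.last n) = q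

end MCSystem

/-!
The order of the sum is described by *reachability* on the disjoint union of the blocks. A step
goes up inside a block, then along a connection, then up inside the block reached, and `p`
reaches `q` if finitely many steps lead from `p` to `q`. Writing `Up q r` if a connection maps `q`
to `r`, the relation `p ≤ q` of the sum means that `p` reaches some `r` with `Up q r`
(`MCSystem.sumLE_toSum_iff`). Everything rests on three properties of reachability.

* Between overlapping blocks it takes a single step (`GluingData.Reach.step_of_conn`).
* It can be carried along connections applied to the source (`GluingData.Reach.push_up`). This is
  the amalgamation axiom, applied along a path, and yields transitivity of the order.
* A path can be rerouted through every index between its ends (`GluingData.Reach.interpolate`).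
  The skeleton being locally finite, this is an induction on covers: two upper covers `y`, `z`
  of `x` overlap with `x`, hence so does `y ⊔ z`, as the filters of the block of `x` meet.

So `(x, a)` has a least reachable element in each block of index above `x`
(`GluingData.exists_least_reach`), and the supremum of `(x, a)` and `(y, b)` is the join of the
least elements that they reach in the block of `x ⊔ y`. Infima are obtained by duality: the
properties used are collected in the self-dual structure `GluingData`.

For modularity, intervals of the sum are finite (`MCSystem.sum_finite_Icc`) and blocks are convex
sublattices. An element and two of its upper covers lie in a common block, since blocks that
share the element can be moved up to their join; dually for lower covers. The blocks being
modular, the sum therefore satisfies both of Birkhoff's covering conditions, which imply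
modularity when intervals are finite (`isModularLattice_of_finite_Icc`).
-/

/-! ### Locally finite orders and lattices -/

section LocallyFinite

variable {α : Type*}

theorem exists_covBy_le_of_finite_Icc [PartialOrder α]
    (hfin : ∀ x y : α, (Set.Icc x y).Finite) {x y : α} (h : x < y) : ∃ z, x ⋖ z ∧ z ≤ y := by
  let _ := LocallyFiniteOrder.ofFiniteIcc hfin
  exact exists_covBy_le_of_lt h

theorem exists_isLeast_of_inf_mem [Lattice α] [Finite α] {s : Set α}
    (hs : s.Nonempty) (h : ∀ a ∈ s, ∀ b ∈ s, a ⊓ b ∈ s) : ∃ a, IsLeast s a := by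
  obtain ⟨m, hm⟩ := s.toFinite.exists_minimal hs
  exact ⟨m, hm.1, fun b hb => (hm.2 (h m hm.1 b hb) inf_le_left).trans inf_le_right⟩

/-- Induction downwards from `y`: to prove `P x`, assume `P` on `(x, y]`. -/
theorem downward_induction_of_finite_Icc [PartialOrder α]
    (hfin : ∀ x y : α, (Set.Icc x y).Finite) {P : α → Prop} (y : α)
    (h : ∀ x ≤ y, (∀ z, x < z → z ≤ y → P z) → P x) : ∀ x ≤ y, P x := by
  intro x
  induction hn : (Set.Icc x y).ncard using Nat.strong_induction_on generalizing x with
  | _ n ih =>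
    intro hxy
    refine h x hxy fun z hxz hzy => ih _ ?_ z rfl hzy
    rw [← hn]
    refine Set.ncard_lt_ncard ⟨Set.Icc_subset_Icc_left hxz.le, fun hsub => ?_⟩ (hfin x y)
    exact (hsub ⟨le_rfl, hxy⟩).1.not_gt hxz

/-- Birkhoff's covering condition implies semimodularity. -/
theorem isUpperModularLattice_of_finite_Icc [Lattice α] [IsWeakUpperModularLattice α]
    (hfin : ∀ x y : α, (Set.Icc x y).Finite) : IsUpperModularLattice α where
  covBy_sup_of_inf_covBy {a b} hab := by
    have key : ∀ c ≤ b, ∀ a, c ⋖ a → ¬ a ≤ b → b ⋖ a ⊔ b := by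
      refine downward_induction_of_finite_Icc hfin b fun c hcb ih a hca hab => ?_
      rcases hcb.eq_or_lt with rfl | h
      · rwa [sup_eq_left.2 hca.le]
      obtain ⟨b', hb', hb'b⟩ := exists_covBy_le_of_finite_Icc hfin h
      have hc : a ⊓ b' = c := by
        rcases hb'.eq_or_eq (le_inf hca.le hb'.le) inf_le_right with h | h
        · exact h
        · rcases hca.eq_or_eq hb'.le (inf_eq_right.1 h) with h' | h'
          · exact absurd h' hb'.lt.ne'
          · exact absurd (h' ▸ hb'b) hab
      have := ih b' hb'.lt hb'b (a ⊔ b')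
        (covBy_sup_of_inf_covBy_of_inf_covBy_right (by rwa [hc]) (by rwa [hc]))
        fun h => hab (le_sup_left.trans h)
      rwa [sup_assoc, sup_eq_right.2 hb'b] at this
    exact key _ inf_le_right a hab fun h => hab.lt.ne (inf_eq_left.2 h)

theorem isLowerModularLattice_of_finite_Icc [Lattice α] [IsWeakLowerModularLattice α]
    (hfin : ∀ x y : α, (Set.Icc x y).Finite) : IsLowerModularLattice α := by
  have := isUpperModularLattice_of_finite_Icc (α := αᵒᵈ) fun x y =>
    (hfin (OrderDual.ofDual y) (OrderDual.ofDual x)).subset fun _ hz => ⟨hz.2, hz.1⟩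
  exact inferInstanceAs (IsLowerModularLattice αᵒᵈᵒᵈ)

/-- Both of Birkhoff's covering conditions together imply modularity. A violation of the modular law
yields a pentagon `p ⋖ r`, `q` with `r ⊓ q ≤ p` and `r ≤ p ⊔ q`; moving one cover up from `r ⊓ q`
towards `q` gives another one with a larger bottom. -/
theorem isModularLattice_of_finite_Icc [Lattice α] [IsWeakUpperModularLattice α]
    [IsWeakLowerModularLattice α] (hfin : ∀ x y : α, (Set.Icc x y).Finite) :
    IsModularLattice α := by
  have := isUpperModularLattice_of_finite_Icc hfin
  have := isLowerModularLattice_of_finite_Icc hfin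
  have key : ∀ q u : α, u ≤ q → ∀ p r, p ⋖ r → r ⊓ q = u → u ≤ p → r ≤ p ⊔ q → False := by
    intro q
    refine downward_induction_of_finite_Icc hfin q ?_
    rintro _ huq ih p r hpr rfl hup hr
    have hne : r ⊓ q ≠ q := fun h => hpr.lt.not_ge (by
      rw [h] at hup; rwa [sup_eq_left.2 hup] at hr)
    obtain ⟨s, hs, hsq⟩ := exists_covBy_le_of_finite_Icc hfin (huq.lt_of_ne hne)
    have hrs : r ⊓ s = r ⊓ q := le_antisymm (inf_le_inf_left r hsq) (le_inf inf_le_left hs.le)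
    have hps : p ⊓ s = r ⊓ q :=
      le_antisymm ((inf_le_inf_right s hpr.le).trans hrs.le) (le_inf hup hs.le)
    have hcp : p ⋖ p ⊔ s := covBy_sup_of_inf_covBy_right (hps ▸ hs)
    have hcr : r ⋖ r ⊔ s := covBy_sup_of_inf_covBy_right (hrs ▸ hs)
    have hnr : ¬ s ≤ r := fun h => hs.lt.not_ge (le_inf h hsq)
    have hmeet : r ⊓ (p ⊔ s) = p := by
      rcases hpr.eq_or_eq (le_inf hpr.le le_sup_left) inf_le_left with h | h
      · exact h
      · have := hcp.eq_or_eq hpr.le (inf_eq_left.1 h)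
        rcases this with h' | h'
        · exact absurd h' hpr.lt.ne'
        · exact absurd (h' ▸ le_sup_right) hnr
    have hcs : p ⊔ s ⋖ r ⊔ s := by
      have := covBy_sup_of_inf_covBy_left (a := r) (b := p ⊔ s) (by rwa [hmeet])
      rwa [← sup_assoc, sup_eq_left.2 hpr.le] at this
    -- Either `p ⊔ s ⋖ r ⊔ s` and `q` form a pentagon with larger bottom, or lower modularity
    -- makes `(r ⊔ s) ⊓ q` a cover of `r ⊓ q`, so that it equals `s` and lies below `p ⊔ s`.
    by_cases hq : (r ⊔ s) ⊓ q ≤ p ⊔ s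
    · refine ih ((r ⊔ s) ⊓ q) (hs.lt.trans_le (le_inf le_sup_right hsq)) inf_le_right
        (p ⊔ s) (r ⊔ s) hcs rfl hq ?_
      exact sup_le (hr.trans (sup_le_sup_right le_sup_left q)) (hsq.trans le_sup_right)
    · have h1 : r ⊔ (r ⊔ s) ⊓ q = r ⊔ s :=
        le_antisymm (sup_le le_sup_left inf_le_left)
          (sup_le le_sup_left ((le_inf le_sup_right hsq).trans le_sup_right))
      have h2 : r ⊓ ((r ⊔ s) ⊓ q) ⋖ (r ⊔ s) ⊓ q :=
        inf_covBy_of_covBy_sup_left (by rwa [h1])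
      have h3 : r ⊓ ((r ⊔ s) ⊓ q) = r ⊓ q := by
        rw [← inf_assoc, inf_eq_left.2 (le_sup_left : r ≤ r ⊔ s)]
      rw [h3] at h2
      rcases h2.eq_or_eq hs.le (le_inf le_sup_right hsq) with h | h
      · exact hs.lt.ne' h
      · exact hq (h ▸ le_sup_right)
  refine ⟨fun {p} q {r} hpr => ?_⟩
  by_contra hne
  have hlt : p ⊔ q ⊓ r < (p ⊔ q) ⊓ r := lt_of_le_not_ge
    (sup_le (le_inf le_sup_left hpr) (inf_le_inf_right r le_sup_right)) hne
  obtain ⟨t, ht, htle⟩ := exists_covBy_le_of_finite_Icc hfin hlt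
  refine key q _ inf_le_right _ t ht rfl ?_ ?_
  · rw [inf_comm]
    exact (inf_le_inf_left q (htle.trans inf_le_right)).trans le_sup_right
  · exact (htle.trans inf_le_left).trans (sup_le_sup_right le_sup_left q)

end LocallyFinite

/-! ### Families of lattices glued along partial isomorphisms -/

/-- Lattices `L x`, indexed by a lattice `S`, and for `x ≤ y` a (possibly empty) partial order
isomorphism from an upper set of `L x` onto a lower set of `L y`, given by its graph `Conn x y`.
The axioms are those properties of the connections of a modular connected system on which the
order of the sum depends; they are invariant under order duality. -/
structure GluingData (S : Type u) [Lattice S] (L : S → Type v) [∀ x, Lattice (L x)] where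
  /-- the graph of the partial isomorphism from `L x` to `L y` -/
  Conn : ∀ x y : S, L x → L y → Prop
  refl : ∀ x a, Conn x x a a
  index_le : ∀ {x y a b}, Conn x y a b → x ≤ y
  trans : ∀ {x y z a b c}, Conn x y a b → Conn y z b c → Conn x z a c
  interpolate : ∀ {x y a b}, Conn x y a b → ∀ {z}, x ≤ z → z ≤ y →
    ∃ c, Conn x z a c ∧ Conn z y c b
  le_iff_le : ∀ {x y a b a' b'}, Conn x y a b → Conn x y a' b' → (a ≤ a' ↔ b ≤ b')
  exists_of_le_left : ∀ {x y a b a'}, Conn x y a b → a ≤ a' → ∃ b', Conn x y a' b'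
  exists_of_le_right : ∀ {x y a b b'}, Conn x y a b → b' ≤ b → ∃ a', Conn x y a' b'
  amalgamate : ∀ {x y z a b c}, Conn x y a b → Conn x z a c →
    ∃ d, Conn y (y ⊔ z) b d ∧ Conn z (y ⊔ z) c d
  coamalgamate : ∀ {x y z a b c}, Conn y x b a → Conn z x c a →
    ∃ d, Conn (y ⊓ z) y d b ∧ Conn (y ⊓ z) z d c
  exists_of_covBy : ∀ {x y}, x ⋖ y → ∃ a b, Conn x y a b
  finite_Icc : ∀ x y : S, (Set.Icc x y).Finite
  finite_block : ∀ x, Finite (L x)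

namespace GluingData

open OrderDual

variable {S : Type u} [Lattice S] {L : S → Type v} [∀ x, Lattice (L x)] (D : GluingData S L)

/-- The order dual of gluing data: skeleton and blocks are reversed. -/
def dual : GluingData Sᵒᵈ (fun x => (L (ofDual x))ᵒᵈ) where
  Conn x y a b := D.Conn (ofDual y) (ofDual x) (ofDual b) (ofDual a)
  refl x a := D.refl (ofDual x) (ofDual a)
  index_le h := D.index_le h
  trans h h' := D.trans h' h
  interpolate h _ h1 h2 := by
    obtain ⟨c, hc⟩ := D.interpolate h h2 h1
    exact ⟨c, hc.2, hc.1⟩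
  le_iff_le h h' := (D.le_iff_le h' h).symm
  exists_of_le_left h h' := D.exists_of_le_right h h'
  exists_of_le_right h h' := D.exists_of_le_left h h'
  amalgamate h h' := D.coamalgamate h h'
  coamalgamate h h' := D.amalgamate h h'
  exists_of_covBy h := by
    obtain ⟨a, b, hab⟩ := D.exists_of_covBy h.ofDual
    exact ⟨b, a, hab⟩
  finite_Icc x y := (D.finite_Icc (ofDual y) (ofDual x)).subset fun _ h => ⟨h.2, h.1⟩
  finite_block x := D.finite_block (ofDual x)

variable {D}

theorem conn_inf {x y : S} {a a' : L x} {b b' : L y} (h : D.Conn x y a b)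
    (h' : D.Conn x y a' b') : D.Conn x y (a ⊓ a') (b ⊓ b') := by
  obtain ⟨c, hc⟩ := D.exists_of_le_right h (inf_le_left : b ⊓ b' ≤ b)
  have hca : c ≤ a ⊓ a' := le_inf ((D.le_iff_le hc h).2 inf_le_left)
    ((D.le_iff_le hc h').2 inf_le_right)
  obtain ⟨d, hd⟩ := D.exists_of_le_left hc hca
  have hdb : d ≤ b ⊓ b' := le_inf ((D.le_iff_le hd h).1 inf_le_left)
    ((D.le_iff_le hd h').1 inf_le_right)
  rwa [le_antisymm ((D.le_iff_le hd hc).2 hdb) hca]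

theorem conn_right_unique {x y : S} {a : L x} {b b' : L y} (h : D.Conn x y a b)
    (h' : D.Conn x y a b') : b = b' :=
  le_antisymm ((D.le_iff_le h h').1 le_rfl) ((D.le_iff_le h' h).1 le_rfl)

variable (D)

/-- `q` is the image of `p` under a connection. -/
def Up (p q : Σ x, L x) : Prop := D.Conn p.1 q.1 p.2 q.2

/-- A step goes up in a block, then along a connection, then up in the block reached. -/
def Step (p q : Σ x, L x) : Prop :=
  ∃ a b, p.2 ≤ a ∧ D.Conn p.1 q.1 a b ∧ b ≤ q.2

/-- Reachability by finitely many steps. -/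
def Reach : (Σ x, L x) → (Σ x, L x) → Prop := Relation.ReflTransGen D.Step

/-- The preorder on the disjoint union of the blocks that induces the order of the sum:
`p` reaches a copy of `q` in a block higher up. -/
def Le (p q : Σ x, L x) : Prop := ∃ r, D.Reach p r ∧ D.Up q r

theorem reach_dual {p q : Σ x, L x} :
    D.dual.Reach ⟨toDual p.1, toDual p.2⟩ ⟨toDual q.1, toDual q.2⟩ ↔ D.Reach q p := by
  have hswap : D.dual.Step = Function.swap D.Step := by
    funext p q
    exact propext ⟨fun ⟨a, b, h1, h2, h3⟩ => ⟨b, a, h3, h2, h1⟩,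
      fun ⟨a, b, h1, h2, h3⟩ => ⟨b, a, h3, h2, h1⟩⟩
  change Relation.ReflTransGen D.dual.Step _ _ ↔ _
  rw [hswap]
  exact Relation.reflTransGen_swap

variable {D}

theorem Step.of_le {x : S} {a b : L x} (h : a ≤ b) : D.Step ⟨x, a⟩ ⟨x, b⟩ :=
  ⟨a, a, le_rfl, D.refl x a, h⟩

theorem Up.step {p q : Σ x, L x} (h : D.Up p q) : D.Step p q := ⟨_, _, le_rfl, h, le_rfl⟩

theorem Step.reach {p q : Σ x, L x} (h : D.Step p q) : D.Reach p q :=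
  Relation.ReflTransGen.single h

theorem Reach.trans {p q r : Σ x, L x} (h : D.Reach p q) (h' : D.Reach q r) : D.Reach p r :=
  Relation.ReflTransGen.trans h h'

theorem Reach.index_le {p q : Σ x, L x} (h : D.Reach p q) : p.1 ≤ q.1 := by
  induction h with
  | refl => exact le_rfl
  | tail _ h ih =>
    obtain ⟨a, b, -, hab, -⟩ := h
    exact ih.trans (D.index_le hab)

/-- Between blocks that overlap, reachability takes a single step. -/
theorem Reach.step_of_conn {p q : Σ x, L x} (h : D.Reach p q) {t : L p.1} {s : L q.1}
    (hts : D.Conn p.1 q.1 t s) : D.Step p q := by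
  induction h using Relation.ReflTransGen.head_induction_on generalizing s with
  | refl => exact ⟨_, _, le_rfl, D.refl _ _, le_rfl⟩
  | @head p p' hpp' hp'q ih =>
    obtain ⟨a, a₁, hpa, haa₁, ha₁⟩ := hpp'
    obtain ⟨s', hs'⟩ := D.exists_of_le_left hts (le_sup_left : t ≤ t ⊔ a)
    obtain ⟨t₁, ht₁, ht₁s⟩ := D.interpolate hs' (D.index_le haa₁) (Reach.index_le hp'q)
    obtain ⟨b, c, hpb, hbc, hcq⟩ := ih ht₁s
    -- pass through the part of `L p'.1` that lies in both overlaps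
    obtain ⟨e, he⟩ := D.exists_of_le_right ht₁ (inf_le_right : b ⊓ t₁ ≤ t₁)
    refine ⟨e, c ⊓ s', hpa.trans ((D.le_iff_le haa₁ he).2 ?_), D.trans he (conn_inf hbc ht₁s),
      inf_le_left.trans hcq⟩
    exact le_inf (ha₁.trans hpb) ((D.le_iff_le haa₁ ht₁).1 le_sup_right)

theorem Reach.le {x : S} {a b : L x} (h : D.Reach ⟨x, a⟩ ⟨x, b⟩) : a ≤ b := by
  obtain ⟨c, d, hac, hcd, hdb⟩ := h.step_of_conn (D.refl x a)
  obtain rfl := conn_right_unique hcd (D.refl x c)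
  exact hac.trans hdb

/-- Copies higher up of the source can be carried along. -/
theorem Reach.push_up {p q p' : Σ x, L x} (h : D.Reach p q) (hp : D.Up p p') :
    ∃ q', D.Up q q' ∧ D.Reach p' q' := by
  induction h with
  | refl => exact ⟨p', hp, .refl⟩
  | @tail q r _ hqr ih =>
    obtain ⟨⟨w, q'⟩, hq', hpq'⟩ := ih
    obtain ⟨a, b, hqa, hab, hbr⟩ := hqr
    obtain ⟨a', ha'⟩ := D.exists_of_le_left hq' hqa
    obtain ⟨c, hbc, ha'c⟩ := D.amalgamate hab ha'
    obtain ⟨c', hc'⟩ := D.exists_of_le_left hbc hbr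
    exact ⟨⟨_, c'⟩, hc', hpq'.tail ⟨a', c, (D.le_iff_le hq' ha').1 hqa, ha'c,
      (D.le_iff_le hbc hc').1 hbr⟩⟩

theorem Reach.push_down {p q q' : Σ x, L x} (h : D.Reach p q) (hq : D.Up q' q) :
    ∃ p', D.Up p' p ∧ D.Reach p' q' := by
  obtain ⟨p', hp', h'⟩ := Reach.push_up (D := D.dual) (p := ⟨toDual q.1, toDual q.2⟩)
    (q := ⟨toDual p.1, toDual p.2⟩) (D.reach_dual.2 h) (p' := ⟨toDual q'.1, toDual q'.2⟩) hq
  exact ⟨⟨ofDual p'.1, ofDual p'.2⟩, hp', D.reach_dual.1 h'⟩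

/-- Steps that stay in a block may be absorbed into the first one that leaves it. -/
theorem Reach.exists_gt_of_ne {p q : Σ x, L x} (h : D.Reach p q) (hne : p.1 ≠ q.1) :
    ∃ p', p.1 < p'.1 ∧ D.Step p p' ∧ D.Reach p' q := by
  induction h using Relation.ReflTransGen.head_induction_on with
  | refl => exact absurd rfl hne
  | @head p p' hpp' hp'q ih =>
    obtain ⟨x, a⟩ := p
    obtain ⟨y, b⟩ := p'
    obtain ⟨c, d, hac, hcd, hdb⟩ := hpp'
    rcases (D.index_le hcd).eq_or_lt with h | h
    · change x = y at h
      subst h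
      obtain ⟨p'', h1, ⟨e, f, hbe, hef⟩, h3⟩ := ih hne
      obtain rfl := conn_right_unique hcd (D.refl _ c)
      exact ⟨p'', h1, ⟨e, f, hac.trans (hdb.trans hbe), hef⟩, h3⟩
    · exact ⟨_, h, ⟨c, d, hac, hcd, hdb⟩, hp'q⟩

/-- Any path can be rerouted through a prescribed index between its ends: two upper covers
of an index, and hence also their join, overlap with it. -/
theorem Reach.interpolate {p q : Σ x, L x} (h : D.Reach p q) {z : S} (hpz : p.1 ≤ z)
    (hzq : z ≤ q.1) : ∃ c : L z, D.Reach p ⟨z, c⟩ ∧ D.Reach ⟨z, c⟩ q := by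
  obtain ⟨x, a⟩ := p
  have hxq : x ≤ q.1 := hpz.trans hzq
  suffices H : ∀ (z : S) (_ : z ≤ q.1) (a : L x), D.Reach ⟨x, a⟩ q → x ≤ z →
      ∃ c : L z, D.Reach ⟨x, a⟩ ⟨z, c⟩ ∧ D.Reach ⟨z, c⟩ q from H z hzq a h hpz
  clear h hpz hzq a z
  refine downward_induction_of_finite_Icc D.finite_Icc
    (P := fun x => ∀ (z : S) (_ : z ≤ q.1) (a : L x), D.Reach ⟨x, a⟩ q → x ≤ z →
      ∃ c : L z, D.Reach ⟨x, a⟩ ⟨z, c⟩ ∧ D.Reach ⟨z, c⟩ q) q.1 ?_ x hxq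
  intro x hxq ih z hzq a haq hxz
  rcases hxz.eq_or_lt with rfl | hxz
  · exact ⟨a, .refl, haq⟩
  obtain ⟨⟨y, b⟩, hxy, hab, hbq⟩ := haq.exists_gt_of_ne (hxz.trans_le hzq).ne
  change x < y at hxy
  have hyq : y ≤ q.1 := hbq.index_le
  obtain ⟨z', hxz', hz'z⟩ := exists_covBy_le_of_finite_Icc D.finite_Icc hxz
  obtain ⟨c, hbc, hcq⟩ := ih y hxy hyq (y ⊔ z') (sup_le hyq (hz'z.trans hzq)) b hbq
    le_sup_left
  -- the filters of `L x` belonging to `y` and to `z'` meet, so `x` overlaps with `y ⊔ z'`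
  obtain ⟨s, t, hst⟩ : ∃ s t, D.Conn x (y ⊔ z') s t := by
    obtain ⟨a₁, b₁, -, h₁, -⟩ := hab
    obtain ⟨a₂, b₂, h₂⟩ := D.exists_of_covBy hxz'
    obtain ⟨b₁', h₁'⟩ := D.exists_of_le_left h₁ (le_sup_left : a₁ ≤ a₁ ⊔ a₂)
    obtain ⟨b₂', h₂'⟩ := D.exists_of_le_left h₂ (le_sup_right : a₂ ≤ a₁ ⊔ a₂)
    obtain ⟨d, hd, -⟩ := D.amalgamate h₁' h₂'
    exact ⟨_, d, D.trans h₁' hd⟩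
  obtain ⟨s, t, has, hst, htc⟩ := Reach.step_of_conn (p := ⟨x, a⟩) (q := ⟨y ⊔ z', c⟩)
    (hab.reach.trans hbc) hst
  obtain ⟨e, hse, het⟩ := D.interpolate hst hxz'.le le_sup_right
  have heq : D.Reach ⟨z', e⟩ q := Reach.trans (q := ⟨y ⊔ z', c⟩)
    (Step.reach ⟨e, t, le_rfl, het, htc⟩) hcq
  obtain ⟨f, hef, hfq⟩ := ih z' hxz'.lt (hz'z.trans hzq) z hzq e heq hz'z
  exact ⟨f, Reach.trans (Step.reach ⟨s, e, has, hse, le_rfl⟩) hef, hfq⟩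

/-- The extension of the connections to join homomorphisms between all blocks: `(x, a)` has a
least reachable element in each block `L y` with `x ≤ y`. -/
theorem exists_least_reach {x y : S} (hxy : x ≤ y) (a : L x) :
    ∃ b : L y, ∀ c, D.Reach ⟨x, a⟩ ⟨y, c⟩ ↔ b ≤ c := by
  revert a
  refine downward_induction_of_finite_Icc D.finite_Icc
    (P := fun x => ∀ a : L x, ∃ b : L y, ∀ c, D.Reach ⟨x, a⟩ ⟨y, c⟩ ↔ b ≤ c) y ?_ x hxy
  intro x hxy ih a
  rcases hxy.eq_or_lt with rfl | hxy
  · exact ⟨a, fun c => ⟨Reach.le, fun h => (Step.of_le h).reach⟩⟩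
  obtain ⟨z, hxz, hzy⟩ := exists_covBy_le_of_finite_Icc D.finite_Icc hxy
  obtain ⟨s, t, hst⟩ := D.exists_of_covBy hxz
  have := D.finite_block z
  obtain ⟨m, ⟨a', ha', hm⟩, hmin⟩ : ∃ m, IsLeast {c | ∃ a', a ≤ a' ∧ D.Conn x z a' c} m := by
    refine exists_isLeast_of_inf_mem ?_ ?_
    · obtain ⟨t', ht'⟩ := D.exists_of_le_left hst (le_sup_left : s ≤ s ⊔ a)
      exact ⟨t', s ⊔ a, le_sup_right, ht'⟩
    · rintro c ⟨a₁, h₁, hc₁⟩ d ⟨a₂, h₂, hc₂⟩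
      exact ⟨a₁ ⊓ a₂, le_inf h₁ h₂, conn_inf hc₁ hc₂⟩
  obtain ⟨b, hb⟩ := ih z hxz.lt hzy m
  refine ⟨b, fun c => ⟨fun h => ?_, fun h => ?_⟩⟩
  · obtain ⟨e, hae, hec⟩ := h.interpolate hxz.le hzy
    obtain ⟨a₁, e₁, h₁, h₂, h₃⟩ := hae.step_of_conn hst
    exact (hb c).1 (Reach.trans (Step.of_le ((hmin ⟨a₁, h₁, h₂⟩).trans h₃)).reach hec)
  · exact Reach.trans (Step.reach ⟨a', m, ha', hm, le_rfl⟩) ((hb c).2 h)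

theorem exists_greatest_reach {x y : S} (hxy : x ≤ y) (b : L y) :
    ∃ a : L x, ∀ c, D.Reach ⟨x, c⟩ ⟨y, b⟩ ↔ c ≤ a := by
  obtain ⟨a, ha⟩ := exists_least_reach (D := D.dual) (x := toDual y) (y := toDual x) hxy
    (toDual b)
  exact ⟨ofDual a, fun c => D.reach_dual.symm.trans (ha (toDual c))⟩

/-- The dual form of the preorder: a copy of `p` lower down reaches `q`. -/
theorem le_iff_exists_down {p q : Σ x, L x} :
    D.Le p q ↔ ∃ r, D.Up r p ∧ D.Reach r q := by
  constructor
  · rintro ⟨r, hpr, hqr⟩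
    exact hpr.push_down hqr
  · rintro ⟨r, hrp, hrq⟩
    obtain ⟨q', hq', h⟩ := hrq.push_up hrp
    exact ⟨q', h, hq'⟩

theorem le_dual {p q : Σ x, L x} :
    D.dual.Le ⟨toDual p.1, toDual p.2⟩ ⟨toDual q.1, toDual q.2⟩ ↔ D.Le q p := by
  rw [le_iff_exists_down (D := D)]
  exact ⟨fun ⟨r, h, h'⟩ => ⟨⟨ofDual r.1, ofDual r.2⟩, h', D.reach_dual.1 h⟩,
    fun ⟨r, h, h'⟩ => ⟨⟨toDual r.1, toDual r.2⟩, D.reach_dual.2 h', h⟩⟩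

theorem Reach.le_of_reach {p q : Σ x, L x} (h : D.Reach p q) : D.Le p q :=
  ⟨q, h, D.refl _ _⟩

theorem Le.trans {p q r : Σ x, L x} (h : D.Le p q) (h' : D.Le q r) : D.Le p r := by
  obtain ⟨q₁, hpq₁, hq⟩ := h
  obtain ⟨r₁, hqr₁, hr⟩ := h'
  obtain ⟨r₂, hr₂, h₂⟩ := hqr₁.push_up hq
  exact ⟨r₂, hpq₁.trans h₂, D.trans hr hr₂⟩

/-- Elements that are equivalent in the preorder have a common copy higher up. -/
theorem Le.exists_up_of_le {p q : Σ x, L x} (h : D.Le p q) (h' : D.Le q p) :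
    ∃ r, D.Up p r ∧ D.Up q r := by
  obtain ⟨⟨y, b⟩, hpb, hqb⟩ := h
  obtain ⟨p₁, hqp₁, hpp₁⟩ := h'
  obtain ⟨p₂, hp₁p₂, hbp₂⟩ := hqp₁.push_up hqb
  obtain ⟨e, hpe, hep₂⟩ := D.interpolate (D.trans hpp₁ hp₁p₂) hpb.index_le hbp₂.index_le
  obtain ⟨a₁, b₁, h₁, h₁', h₁''⟩ := hpb.step_of_conn hpe
  obtain ⟨a₂, b₂, h₂, h₂', h₂''⟩ := hbp₂.step_of_conn hep₂
  have heb : e = b := le_antisymm (((D.le_iff_le hpe h₁').1 h₁).trans h₁'')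
    (h₂.trans ((D.le_iff_le h₂' hep₂).2 h₂''))
  exact ⟨⟨y, b⟩, heb ▸ hpe, hqb⟩

theorem le_block_iff {x : S} {a b : L x} : D.Le ⟨x, a⟩ ⟨x, b⟩ ↔ a ≤ b := by
  constructor
  · rintro ⟨r, har, hbr⟩
    obtain ⟨c, d, hac, hcd, hdr⟩ := har.step_of_conn hbr
    exact hac.trans ((D.le_iff_le hcd hbr).2 hdr)
  · exact fun h => (Step.of_le h).reach.le_of_reach

/-- An element between `p` and `q` has a copy whose index lies between those of `p` and `q`. -/
theorem exists_copy_of_reach_of_le {p q r : Σ x, L x} (hpq : p.1 ≤ q.1) (hpr : D.Le p r)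
    (hrq : D.Le r q) : ∃ z ∈ Set.Icc p.1 q.1, ∃ c : L z, ∃ r', D.Up r r' ∧ D.Up ⟨z, c⟩ r' := by
  obtain ⟨r₁, hpr₁, hrr₁⟩ := hpr
  obtain ⟨r₂, hr₂r, hr₂q⟩ := le_iff_exists_down.1 hrq
  obtain ⟨c, -, hc⟩ := D.interpolate (D.trans hr₂r hrr₁) (z := r₁.1 ⊓ q.1)
    (le_inf (D.index_le (D.trans hr₂r hrr₁)) hr₂q.index_le) inf_le_left
  exact ⟨_, ⟨le_inf hpr₁.index_le hpq, inf_le_right⟩, c, r₁, hrr₁, hc⟩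

/-- The supremum is formed in the block of the join of the indices. -/
theorem exists_sup (D : GluingData S L) (p q : Σ x, L x) :
    ∃ s, D.Le p s ∧ D.Le q s ∧ ∀ r, D.Le p r → D.Le q r → D.Le s r := by
  obtain ⟨c₁, h₁⟩ := exists_least_reach (D := D) (le_sup_left : p.1 ≤ p.1 ⊔ q.1) p.2
  obtain ⟨c₂, h₂⟩ := exists_least_reach (D := D) (le_sup_right : q.1 ≤ p.1 ⊔ q.1) q.2
  refine ⟨⟨p.1 ⊔ q.1, c₁ ⊔ c₂⟩, ((h₁ _).2 le_sup_left).le_of_reach,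
    ((h₂ _).2 le_sup_right).le_of_reach, ?_⟩
  rintro r ⟨r₁, hpr₁, hr₁⟩ ⟨r₂, hqr₂, hr₂⟩
  obtain ⟨d, hd₁, hd₂⟩ := D.amalgamate hr₁ hr₂
  replace hpr₁ := hpr₁.trans (Up.step (q := ⟨_, d⟩) hd₁).reach
  replace hqr₂ := hqr₂.trans (Up.step (q := ⟨_, d⟩) hd₂).reach
  have hle := sup_le hpr₁.index_le hqr₂.index_le
  obtain ⟨e₁, he₁, he₁'⟩ := hpr₁.interpolate le_sup_left hle
  obtain ⟨e₂, he₂, he₂'⟩ := hqr₂.interpolate le_sup_right hle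
  obtain ⟨g, hg⟩ := exists_greatest_reach (D := D) hle d
  refine ⟨⟨_, d⟩, (hg _).2 (sup_le ?_ ?_), D.trans hr₁ hd₁⟩
  · exact ((h₁ _).1 he₁).trans ((hg _).1 he₁')
  · exact ((h₂ _).1 he₂).trans ((hg _).1 he₂')

theorem exists_inf (D : GluingData S L) (p q : Σ x, L x) :
    ∃ s, D.Le s p ∧ D.Le s q ∧ ∀ r, D.Le r p → D.Le r q → D.Le r s := by
  obtain ⟨s, h₁, h₂, h₃⟩ := D.dual.exists_sup ⟨toDual p.1, toDual p.2⟩ ⟨toDual q.1, toDual q.2⟩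
  exact ⟨⟨ofDual s.1, ofDual s.2⟩, le_dual.1 h₁, le_dual.1 h₂, fun r hp hq =>
    le_dual.1 (h₃ ⟨toDual r.1, toDual r.2⟩ (le_dual.2 hp) (le_dual.2 hq))⟩

end GluingData

/-! ### The sum of a modular connected system -/

namespace MCSystem

open GluingData

variable {S : Type u} [Lattice S] {L : S → Type v} [∀ x, Lattice (L x)]
  [∀ x, BoundedOrder (L x)] (C : MCSystem S L)

variable {C} in
theorem Conn.coamalgamate {z x y : S} {d : L z} {a : L x} {b : L y} (h1 : C.Conn x z a d)
    (h2 : C.Conn y z b d) :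
    ∃ c, C.Conn (x ⊓ y) x c a ∧ C.Conn (x ⊓ y) y c b := by
  obtain ⟨d', h3, h4⟩ := sim_iff_conn.1 (sim_of_conn (p := ⟨x, a⟩) (q := ⟨y, b⟩) h1 h2)
  have hγ : C.γ x y := (sim_of_conn (p := ⟨x, a⟩) (q := ⟨y, b⟩) h1 h2).1
  have hd : d' ∈ C.I (C.isTolerance.tolLE_inf_sup hγ) :=
    C.I_inter_subset hγ ⟨h3.mem_I, h4.mem_I⟩
  obtain ⟨c, hc⟩ := (C.φ (C.isTolerance.tolLE_inf_sup hγ)).surjective ⟨d', hd⟩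
  have h5 : C.Conn (x ⊓ y) (x ⊔ y) c d' := ⟨_, c.2, congrArg Subtype.val hc⟩
  obtain ⟨a', h6, h7⟩ := h5.interpolate inf_le_left le_sup_left
  obtain ⟨b', h8, h9⟩ := h5.interpolate inf_le_right le_sup_right
  obtain rfl := h3.left_unique h7
  obtain rfl := h4.left_unique h9
  exact ⟨c, h6, h8⟩

/-- The gluing data given by the graphs of the connections. -/
def gluingData : GluingData S L where
  Conn := C.Conn
  refl := Conn.refl
  index_le h := h.1.1
  trans h h' := h.trans h'
  interpolate h _ h1 h2 := h.interpolate h1 h2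
  le_iff_le := by
    rintro x y a b a' b' ⟨h, ha, rfl⟩ ⟨_, ha', rfl⟩
    exact ((C.φ h).le_iff_le (x := ⟨a, ha⟩) (y := ⟨a', ha'⟩)).symm
  exists_of_le_left := by
    rintro x y a b a' ⟨h, ha, rfl⟩ hle
    exact ⟨_, h, Order.PFilter.mem_of_le hle ha, rfl⟩
  exists_of_le_right := by
    rintro x y a b b' ⟨h, ha, rfl⟩ hle
    obtain ⟨a', ha'⟩ := (C.φ h).surjective ⟨b', (C.I h).lower hle (C.φ h ⟨a, ha⟩).2⟩
    exact ⟨a', h, a'.2, congrArg Subtype.val ha'⟩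
  amalgamate h h' := h.amalgamate h'
  coamalgamate h h' := h.coamalgamate h'
  exists_of_covBy {x y} h := by
    have hxy : TolLE C.γ x y := ⟨h.le, C.tol_of_covBy h⟩
    obtain ⟨a, ha⟩ := (C.F hxy).nonempty
    exact ⟨a, _, hxy, ha, rfl⟩
  finite_Icc := C.skeleton_locallyFinite
  finite_block := C.block_finite

/-- The class in the sum of an element of the disjoint union of the blocks. -/
def toSum (p : Σ x, L x) : C.Sum := C.π p.1 p.2

theorem toSum_surjective (P : C.Sum) : ∃ p, C.toSum p = P := by
  obtain ⟨p, hp⟩ := Quotient.exists_rep P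
  exact ⟨p, hp⟩

variable {C}

theorem toSum_eq_of_up {p q : Σ x, L x} (h : C.gluingData.Up p q) : C.toSum p = C.toSum q :=
  Quotient.sound (s := C.simSetoid) (sim_of_conn h (Conn.refl q.1 q.2))

theorem exists_up_of_toSum_eq {p q : Σ x, L x} (h : C.toSum p = C.toSum q) :
    ∃ r, C.gluingData.Up p r ∧ C.gluingData.Up q r := by
  obtain ⟨c, h1, h2⟩ := sim_iff_conn.1 (Quotient.exact (s := C.simSetoid) h)
  exact ⟨⟨_, c⟩, h1, h2⟩

theorem le_of_toSum_eq {p q : Σ x, L x} (h : C.toSum p = C.toSum q) : C.gluingData.Le p q := by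
  obtain ⟨r, hp, hq⟩ := exists_up_of_toSum_eq h
  exact ⟨r, hp.step.reach, hq⟩

/-- An ascending sequence may be extended below by a block of lower index. -/
theorem IsAscending.cons {n : ℕ} {x : Fin n → S} {a : Fin (n + 1) → C.Sum}
    (h : C.IsAscending x a) {z : S} (hz : ∀ i, z ≤ x i) {P : C.Sum} (hP : C.BlockLE z P (a 0)) :
    C.IsAscending (Fin.cons z x : Fin (n + 1) → S) (Fin.cons P a : Fin (n + 2) → C.Sum) := by
  refine ⟨?_, fun i => ?_⟩
  · intro i j hij
    induction j using Fin.cases with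
    | zero => rw [Fin.le_zero_iff.1 hij]
    | succ j =>
      induction i using Fin.cases with
      | zero => simpa using hz j
      | succ i => simpa using h.1 (Fin.succ_le_succ_iff.1 hij)
  · induction i using Fin.cases with
    | zero => simpa using hP
    | succ i => simpa using h.2 i

theorem exists_isAscending_of_reach {p q : Σ x, L x} (h : C.gluingData.Reach p q) :
    ∃ (n : ℕ) (x : Fin n → S) (a : Fin (n + 1) → C.Sum),
      C.IsAscending x a ∧ a 0 = C.toSum p ∧ a (Fin.last n) = C.toSum q ∧ ∀ i, p.1 ≤ x i := by
  induction h using Relation.ReflTransGen.head_induction_on with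
  | refl => exact ⟨0, Fin.elim0, fun _ => C.toSum q, ⟨fun i => i.elim0, fun i => i.elim0⟩, rfl, rfl,
      fun i => i.elim0⟩
  | @head p p' hpp' _ ih =>
    obtain ⟨n, x, a, h, h0, hl, hx⟩ := ih
    obtain ⟨c, d, hpc, hcd, hdp'⟩ := hpp'
    have hle : p.1 ≤ p'.1 := hcd.1.1
    have hcd' : C.π p.1 c = C.π p'.1 d := toSum_eq_of_up (p := ⟨p.1, c⟩) (q := ⟨p'.1, d⟩) hcd
    have h1 := h.cons (z := p'.1) hx (P := C.π p'.1 d) ⟨d, p'.2, rfl, h0.symm, hdp'⟩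
    have hx1 : ∀ i, p.1 ≤ (Fin.cons p'.1 x : Fin (n + 1) → S) i := by
      intro i
      induction i using Fin.cases with
      | zero => exact hle
      | succ i => exact hle.trans (hx i)
    have h2 := h1.cons (z := p.1) hx1 (P := C.toSum p) ⟨p.2, c, rfl, hcd', hpc⟩
    refine ⟨_, _, _, h2, rfl, ?_, ?_⟩
    · rw [← hl]
      rfl
    · intro i
      induction i using Fin.cases with
      | zero => exact le_rfl
      | succ i => exact hx1 i

theorem BlockLE.le_of_toSum {x : S} {p q : Σ x, L x} (h : C.BlockLE x (C.toSum p) (C.toSum q)) :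
    C.gluingData.Le p q := by
  obtain ⟨a, b, ha, hb, hab⟩ := h
  exact (le_of_toSum_eq ha.symm).trans ((le_block_iff.2 hab).trans (le_of_toSum_eq hb))

theorem SumLE.reflTransGen {P Q : C.Sum} (h : C.SumLE P Q) :
    Relation.ReflTransGen (fun P Q => ∃ x, C.BlockLE x P Q) P Q := by
  obtain ⟨n, x, a, h, rfl, rfl⟩ := h
  have : ∀ i, Relation.ReflTransGen (fun P Q => ∃ x, C.BlockLE x P Q) (a 0) (a i) := by
    intro i
    induction i using Fin.induction with
    | zero => exact .refl
    | succ i ih => exact ih.tail ⟨x i, h.2 i⟩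
  exact this _

/-- The order of the sum in terms of reachability. -/
theorem sumLE_toSum_iff {p q : Σ x, L x} :
    C.SumLE (C.toSum p) (C.toSum q) ↔ C.gluingData.Le p q := by
  constructor
  · intro h
    replace h := h.reflTransGen
    generalize hQ : C.toSum q = Q at h
    induction h generalizing q with
    | refl => exact le_of_toSum_eq hQ.symm
    | @tail Q' Q _ hx ih =>
      obtain ⟨q', rfl⟩ := C.toSum_surjective Q'
      obtain ⟨x, hx⟩ := hx
      subst hQ
      exact (ih rfl).trans hx.le_of_toSum
  · rintro ⟨r, hpr, hqr⟩
    obtain ⟨n, x, a, h, h0, hl, -⟩ := exists_isAscending_of_reach hpr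
    exact ⟨n, x, a, h, h0, hl.trans (toSum_eq_of_up hqr).symm⟩

variable (C)

/-- The lattice structure on the sum whose order is given by ascending sequences. -/
noncomputable instance instLatticeSum : Lattice C.Sum :=
  letI : PartialOrder C.Sum :=
    { le := C.SumLE
      le_refl := fun P => by
        obtain ⟨p, rfl⟩ := C.toSum_surjective P
        exact sumLE_toSum_iff.2 (le_of_toSum_eq rfl)
      le_trans := fun P Q R h h' => by
        obtain ⟨p, rfl⟩ := C.toSum_surjective P
        obtain ⟨q, rfl⟩ := C.toSum_surjective Q
        obtain ⟨r, rfl⟩ := C.toSum_surjective R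
        exact sumLE_toSum_iff.2 ((sumLE_toSum_iff.1 h).trans (sumLE_toSum_iff.1 h'))
      le_antisymm := fun P Q h h' => by
        obtain ⟨p, rfl⟩ := C.toSum_surjective P
        obtain ⟨q, rfl⟩ := C.toSum_surjective Q
        obtain ⟨r, hp, hq⟩ := (sumLE_toSum_iff.1 h).exists_up_of_le (sumLE_toSum_iff.1 h')
        exact (toSum_eq_of_up hp).trans (toSum_eq_of_up hq).symm }
  have hsup : ∀ P Q : C.Sum, ∃ R, P ≤ R ∧ Q ≤ R ∧ ∀ T, P ≤ T → Q ≤ T → R ≤ T := by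
    intro P Q
    obtain ⟨p, rfl⟩ := C.toSum_surjective P
    obtain ⟨q, rfl⟩ := C.toSum_surjective Q
    obtain ⟨s, h1, h2, h3⟩ := C.gluingData.exists_sup p q
    refine ⟨C.toSum s, sumLE_toSum_iff.2 h1, sumLE_toSum_iff.2 h2, fun T hp hq => ?_⟩
    obtain ⟨t, rfl⟩ := C.toSum_surjective T
    exact sumLE_toSum_iff.2 (h3 t (sumLE_toSum_iff.1 hp) (sumLE_toSum_iff.1 hq))
  have hinf : ∀ P Q : C.Sum, ∃ R, R ≤ P ∧ R ≤ Q ∧ ∀ T, T ≤ P → T ≤ Q → T ≤ R := by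
    intro P Q
    obtain ⟨p, rfl⟩ := C.toSum_surjective P
    obtain ⟨q, rfl⟩ := C.toSum_surjective Q
    obtain ⟨s, h1, h2, h3⟩ := C.gluingData.exists_inf p q
    refine ⟨C.toSum s, sumLE_toSum_iff.2 h1, sumLE_toSum_iff.2 h2, fun T hp hq => ?_⟩
    obtain ⟨t, rfl⟩ := C.toSum_surjective T
    exact sumLE_toSum_iff.2 (h3 t (sumLE_toSum_iff.1 hp) (sumLE_toSum_iff.1 hq))
  { (inferInstance : PartialOrder C.Sum) with
    sup := fun P Q => (hsup P Q).choose
    inf := fun P Q => (hinf P Q).choose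
    le_sup_left := fun P Q => (hsup P Q).choose_spec.1
    le_sup_right := fun P Q => (hsup P Q).choose_spec.2.1
    sup_le := fun P Q T h h' => (hsup P Q).choose_spec.2.2 T h h'
    inf_le_left := fun P Q => (hinf P Q).choose_spec.1
    inf_le_right := fun P Q => (hinf P Q).choose_spec.2.1
    le_inf := fun T P Q h h' => (hinf P Q).choose_spec.2.2 T h h' }

variable {C}

theorem toSum_le_toSum {p q : Σ x, L x} : C.toSum p ≤ C.toSum q ↔ C.gluingData.Le p q :=
  sumLE_toSum_iff

theorem sum_finite_Icc (P Q : C.Sum) : (Set.Icc P Q).Finite := by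
  rcases (Set.Icc P Q).eq_empty_or_nonempty with h | ⟨R, hPR, hRQ⟩
  · exact h ▸ Set.finite_empty
  obtain ⟨p, rfl⟩ := C.toSum_surjective P
  obtain ⟨q, rfl⟩ := C.toSum_surjective Q
  obtain ⟨q', hpq', hqq'⟩ := toSum_le_toSum.1 (hPR.trans hRQ)
  rw [toSum_eq_of_up hqq']
  have := C.block_finite
  refine ((C.skeleton_locallyFinite p.1 q'.1).biUnion fun z _ =>
    Set.finite_range (C.π z)).subset ?_
  rintro R ⟨hpR, hRq⟩
  obtain ⟨r, rfl⟩ := C.toSum_surjective R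
  obtain ⟨z, hz, c, r', hr, hc⟩ := exists_copy_of_reach_of_le hpq'.index_le (toSum_le_toSum.1 hpR)
    (toSum_le_toSum.1 hRq)
  exact Set.mem_biUnion hz ⟨c, (toSum_eq_of_up hc).trans (toSum_eq_of_up hr).symm⟩

variable (C) in
/-- Each block embeds in the sum. -/
noncomputable def πEmbedding (x : S) : L x ↪o C.Sum :=
  OrderEmbedding.ofMapLEIff (C.π x) fun _ _ => toSum_le_toSum.trans le_block_iff

theorem ordConnected_range_π (x : S) : (Set.range (C.πEmbedding x)).OrdConnected := by
  refine ⟨?_⟩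
  rintro _ ⟨a, rfl⟩ _ ⟨b, rfl⟩ R ⟨haR, hRb⟩
  obtain ⟨r, rfl⟩ := C.toSum_surjective R
  obtain ⟨z, hz, c, r', hr, hc⟩ := exists_copy_of_reach_of_le (p := ⟨x, a⟩) (q := ⟨x, b⟩) le_rfl
    (toSum_le_toSum.1 haR) (toSum_le_toSum.1 hRb)
  obtain rfl : z = x := le_antisymm hz.2 hz.1
  exact ⟨c, (toSum_eq_of_up hc).trans (toSum_eq_of_up hr).symm⟩

theorem π_sup (x : S) (a b : L x) :
    C.πEmbedding x (a ⊔ b) = C.πEmbedding x a ⊔ C.πEmbedding x b := by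
  have hle : C.πEmbedding x a ⊔ C.πEmbedding x b ≤ C.πEmbedding x (a ⊔ b) :=
    sup_le ((C.πEmbedding x).monotone le_sup_left) ((C.πEmbedding x).monotone le_sup_right)
  obtain ⟨c, hc⟩ := (ordConnected_range_π x).out ⟨a, rfl⟩ ⟨a ⊔ b, rfl⟩ ⟨le_sup_left, hle⟩
  refine le_antisymm ?_ hle
  rw [← hc, (C.πEmbedding x).le_iff_le]
  exact sup_le ((C.πEmbedding x).le_iff_le.1 (hc ▸ le_sup_left))
    ((C.πEmbedding x).le_iff_le.1 (hc ▸ le_sup_right))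

theorem π_inf (x : S) (a b : L x) :
    C.πEmbedding x (a ⊓ b) = C.πEmbedding x a ⊓ C.πEmbedding x b := by
  have hle : C.πEmbedding x (a ⊓ b) ≤ C.πEmbedding x a ⊓ C.πEmbedding x b :=
    le_inf ((C.πEmbedding x).monotone inf_le_left) ((C.πEmbedding x).monotone inf_le_right)
  obtain ⟨c, hc⟩ := (ordConnected_range_π x).out ⟨a ⊓ b, rfl⟩ ⟨a, rfl⟩ ⟨hle, inf_le_left⟩
  refine le_antisymm hle ?_
  rw [← hc, (C.πEmbedding x).le_iff_le]
  exact le_inf ((C.πEmbedding x).le_iff_le.1 (hc ▸ inf_le_left))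
    ((C.πEmbedding x).le_iff_le.1 (hc ▸ inf_le_right))

theorem le_of_reflTransGen {P Q : C.Sum}
    (h : Relation.ReflTransGen (fun P Q => ∃ x, C.BlockLE x P Q) P Q) : P ≤ Q := by
  induction h with
  | refl => exact le_rfl
  | tail _ h ih =>
    obtain ⟨x, a, b, rfl, rfl, hab⟩ := h
    exact ih.trans ((C.πEmbedding x).monotone hab)

theorem exists_block_of_covBy {P Q : C.Sum} (h : P ⋖ Q) :
    ∃ x, ∃ a b : L x, C.πEmbedding x a = P ∧ C.πEmbedding x b = Q := by
  have hPQ : Relation.ReflTransGen (fun P Q => ∃ x, C.BlockLE x P Q) P Q :=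
    SumLE.reflTransGen h.le
  induction hPQ using Relation.ReflTransGen.head_induction_on with
  | refl => exact absurd rfl h.ne
  | @head P R hPR hRQ ih =>
    obtain ⟨x, a, b, hP, hR, hab⟩ := hPR
    change C.πEmbedding x a = P at hP
    change C.πEmbedding x b = R at hR
    have hRQ' : R ≤ Q := le_of_reflTransGen hRQ
    have hPR : P ≤ R := hP ▸ hR ▸ (C.πEmbedding x).monotone hab
    rcases h.eq_or_eq hPR hRQ' with hR' | hR'
    · subst hR'
      exact ih h
    · exact ⟨x, a, b, hP, hR.trans hR'⟩

/-- Two upper covers of an element lie in a common block with it: the copies of the element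
in the two blocks have a common copy higher up, to which the covers can be carried. -/
theorem exists_block_of_upperCovers {P Q R : C.Sum} (hQ : P ⋖ Q) (hR : P ⋖ R) :
    ∃ x, ∃ a b c : L x, C.πEmbedding x a = P ∧ C.πEmbedding x b = Q ∧ C.πEmbedding x c = R := by
  obtain ⟨x, a, b, haP, rfl⟩ := exists_block_of_covBy hQ
  obtain ⟨y, a', c, rfl, rfl⟩ := exists_block_of_covBy hR
  obtain ⟨⟨z, d⟩, had, ha'd⟩ := exists_up_of_toSum_eq (p := ⟨x, a⟩) (q := ⟨y, a'⟩) haP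
  have hab : a ≤ b := (C.πEmbedding x).le_iff_le.1 (haP ▸ hQ.le)
  obtain ⟨e, he⟩ := C.gluingData.exists_of_le_left had hab
  obtain ⟨f, hf⟩ := C.gluingData.exists_of_le_left ha'd ((C.πEmbedding y).le_iff_le.1 hR.le)
  exact ⟨z, d, e, f, (toSum_eq_of_up ha'd).symm,
    (toSum_eq_of_up (p := ⟨x, b⟩) (q := ⟨z, e⟩) he).symm,
    (toSum_eq_of_up (p := ⟨y, c⟩) (q := ⟨z, f⟩) hf).symm⟩

theorem exists_block_of_lowerCovers {P Q R : C.Sum} (hQ : Q ⋖ P) (hR : R ⋖ P) :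
    ∃ x, ∃ a b c : L x, C.πEmbedding x a = P ∧ C.πEmbedding x b = Q ∧ C.πEmbedding x c = R := by
  obtain ⟨x, b, a, rfl, haP⟩ := exists_block_of_covBy hQ
  obtain ⟨y, c, a', rfl, rfl⟩ := exists_block_of_covBy hR
  obtain ⟨r, hr, hr'⟩ := exists_up_of_toSum_eq (p := ⟨x, a⟩) (q := ⟨y, a'⟩) haP
  obtain ⟨d, hd, hd'⟩ := C.gluingData.coamalgamate hr hr'
  have hba : b ≤ a := (C.πEmbedding x).le_iff_le.1 (haP ▸ hQ.le)
  obtain ⟨e, he⟩ := C.gluingData.exists_of_le_right hd hba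
  obtain ⟨f, hf⟩ := C.gluingData.exists_of_le_right hd' ((C.πEmbedding y).le_iff_le.1 hR.le)
  exact ⟨x ⊓ y, d, e, f, toSum_eq_of_up (p := ⟨_, d⟩) (q := ⟨y, a'⟩) hd',
    toSum_eq_of_up (p := ⟨_, e⟩) (q := ⟨x, b⟩) he,
    toSum_eq_of_up (p := ⟨_, f⟩) (q := ⟨y, c⟩) hf⟩

theorem isWeakUpperModularLattice_sum : IsWeakUpperModularLattice C.Sum where
  covBy_sup_of_inf_covBy_covBy {P Q} hP hQ := by
    obtain ⟨x, a, b, c, ha, rfl, rfl⟩ := exists_block_of_upperCovers hP hQ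
    have := C.block_modular x
    rw [← π_inf, (ordConnected_range_π x).apply_covBy_apply_iff] at hQ
    rw [← π_sup, (ordConnected_range_π x).apply_covBy_apply_iff]
    exact covBy_sup_of_inf_covBy_right hQ

theorem isWeakLowerModularLattice_sum : IsWeakLowerModularLattice C.Sum where
  inf_covBy_of_covBy_covBy_sup {P Q} hP hQ := by
    obtain ⟨x, a, b, c, ha, rfl, rfl⟩ := exists_block_of_lowerCovers hP hQ
    have := C.block_modular x
    rw [← π_sup, (ordConnected_range_π x).apply_covBy_apply_iff] at hQ
    rw [← π_inf, (ordConnected_range_π x).apply_covBy_apply_iff]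
    exact inf_covBy_of_covBy_sup_right hQ

end MCSystem

theorem mainTheorem3 {S : Type u} [Lattice S] {L : S → Type v} [∀ x, Lattice (L x)]
    [∀ x, BoundedOrder (L x)] (C : MCSystem S L) :
    ∃ inst : Lattice C.Sum, (∀ p q : C.Sum, inst.le p q ↔ C.SumLE p q) ∧
      @IsModularLattice C.Sum inst := by
  have := MCSystem.isWeakUpperModularLattice_sum (C := C)
  have := MCSystem.isWeakLowerModularLattice_sum (C := C)
  exact ⟨C.instLatticeSum, fun _ _ => Iff.rfl,
    isModularLattice_of_finite_Icc MCSystem.sum_finite_Icc⟩
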